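/- Let $G=(V,E)$ be a finite simple graph with $V\neq\emptyset$ and without isolated vertices. Let $\mathcal V$ be the family of all sets $V(m)\subseteq V$, where $m$ runs over the matchings of $G$ (including the empty one) and $V(m)$ is the set of vertices covered by $m$. Let $p_R$ (Rawlsian justice for fair matching for vertices) be the largest real number $p$ for which there is a probability distribution $(x_S)_{S\in\mathcal V}$ on $\mathcal V$ with $\sum_{S\in\mathcal V,\ v\in S} x_S\ge p$ for every $v\in V$. If $G$ is regular, then $p_R\ge \frac23$. If $G$ is not regular, then $$p_R\ \ge\ \frac{1}{\Delta(G)-\delta(G)+1},$$ where $\Delta(G)$ and $\delta(G)$ are the maximum and minimum degree of $G$. -/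

import Mathlib

namespace FairMatching

/-- `(x, p)` is a feasible point of the linear program that defines Rawlsian justice for the family
`M` of subsets of the ground set `A`: `x` is a probability distribution on the members of `M` (its
values outside `M` play no role), and a random member of `M` drawn according to `x` contains each
element of the ground set with probability at least `p`. -/
structure IsRawlsFeasible {A : Type*} [DecidableEq A] (M : Finset (Finset A))
    (x : Finset A → ℝ) (p : ℝ) : Prop where
  covers : ∀ a : A, p ≤ ∑ m ∈ M with a ∈ m, x m
  sum_eq_one : ∑ m ∈ M, x m = 1
  nonneg : ∀ m ∈ M, 0 ≤ x m

/-- The objective values that are feasible for the linear program of Rawlsian justice. -/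
def rawlsValues {A : Type*} [DecidableEq A] (M : Finset (Finset A)) : Set ℝ :=
  {p | ∃ x : Finset A → ℝ, IsRawlsFeasible M x p}

/-- The Rawlsian fairness measure `p_R` of the set system `(A, M)`: the optimal value of the linear
program. It is a maximum whenever `A` and `M` are non-empty, see `isGreatest_pR`. -/
noncomputable def pR {A : Type*} [DecidableEq A] (M : Finset (Finset A)) : ℝ :=
  sSup (rawlsValues M)

open Classical in
/-- The family `V(M)` of all vertex sets that are covered by some matching of `G`. (A matching is
represented by the subgraph that consists of its edges and their endpoints, so that `m.verts` is
the set of covered vertices.) -/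
noncomputable def coveredSets {V : Type*} [Fintype V] (G : SimpleGraph V) : Finset (Finset V) :=
  {s : Finset V | ∃ m : G.Subgraph, m.IsMatching ∧ m.verts = (s : Set V)}

/-- `p_R` for the problem of fair matching for vertices in `G`. -/
noncomputable def pRVertices {V : Type*} [Fintype V] [DecidableEq V] (G : SimpleGraph V) : ℝ :=
  pR (coveredSets G)

/-- The linear program attains its optimum, so `p_R` is a maximum. -/
theorem isGreatest_pR {A : Type*} [Fintype A] [DecidableEq A] [Nonempty A]
    (M : Finset (Finset A)) (hM : M.Nonempty) : IsGreatest (rawlsValues M) (pR M) := by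
  classical
  have : Nonempty M := hM.to_subtype
  let f : (M → ℝ) → ℝ := fun y =>
    Finset.univ.inf' Finset.univ_nonempty
      (fun a : A => ∑ m : M, if a ∈ m.1 then y m else 0)
  have hf : Continuous f := by
    refine Continuous.finset_inf'_apply _ fun a _ => ?_
    refine continuous_finsetSum _ fun m _ => ?_
    split_ifs
    · exact continuous_apply m
    · exact continuous_const
  have hne : (stdSimplex ℝ M).Nonempty :=
    ⟨_, single_mem_stdSimplex ℝ (Classical.arbitrary M)⟩
  obtain ⟨y, hy, hmax⟩ := (isCompact_stdSimplex ℝ M).exists_isMaxOn hne hf.continuousOn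
  have key : IsGreatest (rawlsValues M) (f y) := by
    constructor
    · refine ⟨fun m => if h : m ∈ M then y ⟨m, h⟩ else 0, ?_, ?_, ?_⟩
      · intro a
        refine (Finset.inf'_le _ (Finset.mem_univ a)).trans (le_of_eq ?_)
        rw [Finset.sum_filter, ← Finset.sum_coe_sort M]
        refine Finset.sum_congr rfl fun m _ => ?_
        simp
      · rw [← hy.2, ← Finset.sum_coe_sort M]
        refine Finset.sum_congr rfl fun m _ => ?_
        simp
      · intro m hm
        simpa [hm] using hy.1 ⟨m, hm⟩
    · rintro p ⟨x, hx⟩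
      have hx' : (fun m : M => x m.1) ∈ stdSimplex ℝ M :=
        ⟨fun m => hx.nonneg m.1 m.2, by
          rw [← hx.sum_eq_one, ← Finset.sum_coe_sort M]⟩
      refine le_trans ?_ (hmax hx')
      refine Finset.le_inf' _ _ fun a _ => ?_
      refine (hx.covers a).trans (le_of_eq ?_)
      rw [Finset.sum_filter, ← Finset.sum_coe_sort M]
  have h : pR M = f y := key.csSup_eq
  rw [h]
  exact key

/-- The empty matching covers the empty set. -/
theorem empty_mem_coveredSets {V : Type*} [Fintype V] (G : SimpleGraph V) :
    ∅ ∈ coveredSets G := by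
  classical
  simp only [coveredSets, Finset.mem_filter, Finset.mem_univ, true_and]
  exact ⟨⊥, fun v hv => absurd hv (by simp), by simp⟩

/-- The two endpoints of an edge are covered by a matching; so without isolated vertices every
vertex lies in a member of the family. -/
theorem pair_mem_coveredSets {V : Type*} [Fintype V] [DecidableEq V] (G : SimpleGraph V)
    {u v : V} (h : G.Adj u v) : {u, v} ∈ coveredSets G := by
  simp only [coveredSets, Finset.mem_filter, Finset.mem_univ, true_and]
  exact ⟨G.subgraphOfAdj h, SimpleGraph.Subgraph.IsMatching.subgraphOfAdj h, by simp⟩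

end FairMatching

/-! If each vertex is covered by at least r of k matchings, a uniformly random one of them shows
`p_R` ≥ r/k. Such matchings come from Hall's theorem: counting the edges between a set and its
neighbourhood shows that, if Δ ≤ kδ, every vertex can choose a neighbour with none chosen more than
k times.

For regular G take k = 1: the choice is a permutation along edges. An even cycle has a perfect
matching, an odd one a matching that misses any prescribed vertex. Varying that vertex gives three
matchings, each vertex missed at most once.

Otherwise k = Δ - δ + 1 ≥ 2 satisfies Δ ≤ kδ. An extremal choice makes every chosen vertex part of a
mutually choosing pair, so the chosen edges form double stars. These split into k matchings that
together cover every vertex. -/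

namespace FairMatching

open Finset

/-! ### Lower bounds from families of matchings -/

section LowerBound

/-- A uniformly random member of a finite family of matchings is a feasible distribution. -/
theorem le_pRVertices_of_matchings {V ι : Type*} [Fintype V] [DecidableEq V] [Nonempty V]
    [Fintype ι] [Nonempty ι] (G : SimpleGraph V) (M : ι → G.Subgraph)
    (hM : ∀ i, (M i).IsMatching) (S : ι → Finset V) (hS : ∀ i, (S i : Set V) = (M i).verts)
    (p : ℝ) (hp : ∀ v, p * Fintype.card ι ≤ #{i | v ∈ S i}) : p ≤ pRVertices G := by
  classical
  have hpos : (0 : ℝ) < Fintype.card ι := by exact_mod_cast Fintype.card_pos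
  have hmem : ∀ i, S i ∈ coveredSets G := fun i => by
    simp only [coveredSets, mem_filter, mem_univ, true_and]
    exact ⟨M i, hM i, (hS i).symm⟩
  refine (isGreatest_pR (coveredSets G) ⟨∅, empty_mem_coveredSets G⟩).2
    -- Different indices may cover the same set, so the weight of a set counts its fibre.
    ⟨fun m => (#{i | S i = m} : ℝ) / Fintype.card ι, ?_, ?_, fun m _ => by positivity⟩
  · intro v
    rw [← sum_div, le_div_iff₀ hpos]
    refine (hp v).trans (le_of_eq ?_)
    rw [card_eq_sum_card_fiberwise (f := S) (t := {m ∈ coveredSets G | v ∈ m})]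
    · push_cast
      refine sum_congr rfl fun m hm => ?_
      congr 2
      ext i
      simp only [mem_filter, mem_univ, true_and, and_iff_right_iff_imp] at hm ⊢
      rintro rfl
      exact hm.2
    · intro i hi
      simp only [coe_filter, mem_univ, true_and, Set.mem_ofPred_eq] at hi ⊢
      exact ⟨hmem i, hi⟩
  · rw [← sum_div, div_eq_one_iff_eq hpos.ne', ← card_univ,
      card_eq_sum_card_fiberwise (f := S) (t := coveredSets G) fun i _ => hmem i]
    push_cast
    rfl

end LowerBound

/-! ### Bounded choice of neighbours -/

section Hall

/-- Hall's condition for neighbourhoods taken with multiplicity `|κ|`. -/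
theorem exists_injective_adj {V κ : Type*} [Fintype V] [DecidableEq V] [Fintype κ]
    (G : SimpleGraph V) [DecidableRel G.Adj] (hδ : 0 < G.minDegree)
    (hκ : G.maxDegree ≤ Fintype.card κ * G.minDegree) :
    ∃ φ : V → V × κ, Function.Injective φ ∧ ∀ v, G.Adj v (φ v).1 := by
  classical
  obtain ⟨φ, hφ, h⟩ := (all_card_le_biUnion_card_iff_exists_injective
    fun v => G.neighborFinset v ×ˢ (univ : Finset κ)).1 fun s => by
      have hprod : s.biUnion (fun v => G.neighborFinset v ×ˢ (univ : Finset κ)) =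
          s.biUnion (fun v => G.neighborFinset v) ×ˢ univ := by
        ext ⟨a, b⟩
        simp
      rw [hprod, card_product, card_univ]
      have hcount : #s * G.minDegree ≤ #(s.biUnion fun v => G.neighborFinset v) * G.maxDegree := by
        refine card_mul_le_card_mul G.Adj (fun a ha => ?_) fun b _ => ?_
        · refine (G.minDegree_le_degree a).trans (card_le_card fun w hw => ?_)
          rw [mem_bipartiteAbove]
          exact ⟨mem_biUnion.2 ⟨a, ha, hw⟩, (G.mem_neighborFinset a w).1 hw⟩
        · refine le_trans (card_le_card fun w hw => ?_) (G.degree_le_maxDegree b)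
          rw [mem_bipartiteBelow] at hw
          exact (G.mem_neighborFinset b w).2 hw.2.symm
      refine Nat.le_of_mul_le_mul_right (hcount.trans ?_) hδ
      rw [mul_assoc]
      exact Nat.mul_le_mul_left _ hκ
  exact ⟨φ, hφ, fun v => by simpa using h v⟩

end Hall

/-! ### Double stars and their edge colouring -/

section Stars

/-- If every vertex has a chosen neighbour and each vertex is chosen at most `|κ| ≥ 2` times, then
the choice can be made such that every chosen vertex and its own choice choose each other. -/
theorem exists_injective_adj_retract {V κ : Type*} [Fintype V] [Fintype κ] [Nontrivial κ]
    (G : SimpleGraph V) (h : ∃ φ : V → V × κ, Function.Injective φ ∧ ∀ v, G.Adj v (φ v).1) :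
    ∃ φ : V → V × κ, Function.Injective φ ∧ (∀ v, G.Adj v (φ v).1) ∧
      ∀ v, (φ (φ (φ v).1).1).1 = (φ v).1 := by
  classical
  let P : (V → V × κ) → Prop := fun φ => Function.Injective φ ∧ ∀ v, G.Adj v (φ v).1
  let N : (V → V × κ) → Finset V := fun φ => {v | (φ (φ v).1).1 = v}
  -- Maximise the number of vertices in mutually choosing pairs.
  obtain ⟨φ, hφ, hmax⟩ := exists_max_image ({φ | P φ} : Finset (V → V × κ)) (fun φ => #(N φ))
    (by obtain ⟨φ, hφ⟩ := h; exact ⟨φ, by simpa using hφ⟩)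
  simp only [mem_filter, mem_univ, true_and] at hφ hmax
  refine ⟨φ, hφ.1, hφ.2, ?_⟩
  let T : Finset V := {v | (φ (φ (φ v).1).1).1 ≠ (φ v).1}
  -- If the slot `(v, j)` were free, redirecting `(φ v).1` to it would create a mutual pair and
  -- destroy none, since `(φ v).1` was in none.
  have hT : ∀ v ∈ T, ∀ j : κ, ∃ t, φ t = (v, j) := by
    intro v hv j
    by_contra! hj
    have hv : (φ (φ (φ v).1).1).1 ≠ (φ v).1 := by simpa [T] using hv
    have huv : (φ v).1 ≠ v := (hφ.2 v).ne'
    have hP : P (Function.update φ (φ v).1 (v, j)) := by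
      refine ⟨fun a b hab => ?_, fun a => ?_⟩
      · by_cases ha : a = (φ v).1 <;> by_cases hb : b = (φ v).1
        · rw [ha, hb]
        · subst ha
          simp [hb] at hab
          exact absurd hab.symm (hj b)
        · subst hb
          simp [ha] at hab
          exact absurd hab (hj a)
        · simp only [Function.update_of_ne ha, Function.update_of_ne hb] at hab
          exact hφ.1 hab
      · by_cases ha : a = (φ v).1
        · subst ha
          simpa using (hφ.2 v).symm
        · simpa [Function.update_of_ne ha] using hφ.2 a
    refine (hmax _ hP).not_gt (card_lt_card ⟨fun a ha => ?_, fun hsub => ?_⟩)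
    · have ha : (φ (φ a).1).1 = a := by simpa [N] using ha
      have h1 : a ≠ (φ v).1 := by rintro rfl; exact hv ha
      have h2 : (φ a).1 ≠ (φ v).1 := by
        intro h2
        rw [h2] at ha
        rw [ha] at hv
        exact hv h2
      simp [N, Function.update_of_ne h1, Function.update_of_ne h2, ha]
    · have : (φ v).1 ∈ N φ := hsub (by simp [N, Function.update_of_ne huv.symm])
      exact hv (by simpa [N] using this)
  -- Whoever chooses `v ∈ T` is itself in `T`: were `v` in a mutual pair, its choice would be too.
  -- So `T` fills `|T| * |κ|` slots with at most `|T|` choices, which forces `T = ∅` as `|κ| ≥ 2`.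
  have hsub : T ×ˢ (univ : Finset κ) ⊆ T.image φ := by
    rintro ⟨v, j⟩ hvj
    obtain ⟨hv, -⟩ := mem_product.1 hvj
    obtain ⟨t, ht⟩ := hT v hv j
    refine mem_image.2 ⟨t, ?_, ht⟩
    simp only [T, mem_filter, mem_univ, true_and, ht] at hv ⊢
    intro h
    rw [h] at hv
    exact hv rfl
  have hcard := (card_le_card hsub).trans card_image_le
  rw [card_product, card_univ] at hcard
  have hκ : 1 < Fintype.card κ := Fintype.one_lt_card
  have hT0 : #T = 0 := by nlinarith
  intro v
  by_contra hv
  have : v ∈ T := by simpa [T] using hv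
  simp [card_eq_zero.1 hT0] at this

/-- The edges `v — f v` with `c v = i`. -/
def colorSubgraph {V κ : Type*} (G : SimpleGraph V) (f : V → V) (hf : ∀ v, G.Adj v (f v))
    (c : V → κ) (i : κ) : G.Subgraph where
  verts := {v | c v = i ∨ ∃ w, c w = i ∧ f w = v}
  Adj a b := (c a = i ∧ f a = b) ∨ (c b = i ∧ f b = a)
  adj_sub := by
    rintro a b (⟨-, rfl⟩ | ⟨-, rfl⟩)
    · exact hf a
    · exact (hf b).symm
  edge_vert := by
    rintro a b (⟨h, -⟩ | ⟨h, h'⟩)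
    · exact Or.inl h
    · exact Or.inr ⟨b, h, h'⟩
  symm := ⟨fun _ _ h => h.symm⟩

/-- The colour `z` is reserved for mutual pairs. If `w` chooses `v` and both have colour `i`, then
`v`, being chosen, is in a mutual pair, so `i = z` and `w` is its partner. Two vertices with the
same choice differ in colour. -/
theorem isMatching_colorSubgraph {V κ : Type*} (G : SimpleGraph V) (f : V → V)
    (hf : ∀ v, G.Adj v (f v)) (hfff : ∀ v, f (f (f v)) = f v) (c : V → κ)
    (hinj : ∀ v w, f v = f w → c v = c w → v = w) (z : κ) (hz : ∀ v, c v = z ↔ f (f v) = v)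
    (i : κ) : (colorSubgraph G f hf c i).IsMatching := by
  have key : ∀ v w, c v = i → c w = i → f w = v → f v = w := by
    rintro v w hv hw rfl
    have hi : i = z := hv ▸ (hz _).2 (hfff w)
    exact (hz w).1 (hw.trans hi)
  intro v hv
  refine existsUnique_of_exists_of_unique ?_ ?_
  · rcases hv with hv | ⟨w, hw⟩
    · exact ⟨f v, Or.inl ⟨hv, rfl⟩⟩
    · exact ⟨w, Or.inr hw⟩
  · rintro a b (⟨h, rfl⟩ | ⟨h, rfl⟩) (⟨h', rfl⟩ | ⟨h', h''⟩)
    · rfl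
    · exact key _ _ h h' h''
    · exact (key _ _ h' h rfl).symm
    · exact hinj _ _ h''.symm (h.trans h'.symm)

theorem one_div_card_le_pRVertices {V κ : Type*} [Fintype V] [DecidableEq V] [Nonempty V]
    [Fintype κ] [Nontrivial κ] (G : SimpleGraph V)
    (h : ∃ φ : V → V × κ, Function.Injective φ ∧ ∀ v, G.Adj v (φ v).1) :
    1 / (Fintype.card κ : ℝ) ≤ pRVertices G := by
  classical
  obtain ⟨φ, hinj, hadj, hr⟩ := exists_injective_adj_retract G h
  let f : V → V := fun v => (φ v).1
  let z : κ := Classical.arbitrary κ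
  -- Among the vertices choosing `f v`, the one chosen back is `f (f v)`. The swap, which depends
  -- only on `f v`, moves its label to `z` and keeps labels distinct.
  let c : V → κ := fun v => Equiv.swap (φ (f (f v))).2 z (φ v).2
  have hc : ∀ v w, f v = f w → c v = c w → v = w := by
    intro v w hvw h
    simp only [c, hvw] at h
    exact hinj (Prod.ext hvw ((Equiv.swap _ _).injective h))
  have hz : ∀ v, c v = z ↔ f (f v) = v := by
    refine fun v => ⟨fun h => hc _ _ (hr v) ?_, fun h => by simp [c, h]⟩
    rw [h]
    have : f (f (f (f v))) = f (f v) := hr (f v)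
    simp [c, this]
  have hpos : (0 : ℝ) < Fintype.card κ := by exact_mod_cast Fintype.card_pos
  refine le_pRVertices_of_matchings G (colorSubgraph G f hadj c)
    (isMatching_colorSubgraph G f hadj hr c hc z hz)
    (fun i => (colorSubgraph G f hadj c i).verts.toFinset) (fun i => by simp) _ fun v => ?_
  rw [one_div_mul_cancel hpos.ne']
  have : 0 < #{i | v ∈ (colorSubgraph G f hadj c i).verts.toFinset} :=
    card_pos.2 ⟨c v, mem_filter.2 ⟨mem_univ _, Set.mem_toFinset.2 (Or.inl rfl)⟩⟩
  exact_mod_cast this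

end Stars

/-! ### Matchings along the cycles of a permutation -/

section Cycles

/-- An injective walk with an even number of vertices is covered by a matching. -/
theorem exists_isMatching_verts_image {V : Type*} (G : SimpleGraph V) (a : ℕ → V) (m : ℕ)
    (hinj : Set.InjOn a (Set.Iio (2 * m))) (hadj : ∀ j, G.Adj (a j) (a (j + 1))) :
    ∃ M : G.Subgraph, M.IsMatching ∧ M.verts = a '' Set.Iio (2 * m) := by
  induction m with
  | zero => exact ⟨⊥, fun v hv => absurd hv (by simp), by simp⟩
  | succ m ih =>
    obtain ⟨M, hM, hv⟩ := ih (hinj.mono fun x hx => by simp only [Set.mem_Iio] at *; omega)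
    have hIio : Set.Iio (2 * (m + 1)) = Set.Iio (2 * m) ∪ {2 * m, 2 * m + 1} := by
      ext x
      simp only [Set.mem_Iio, Set.mem_union, Set.mem_insert_iff, Set.mem_singleton_iff]
      omega
    have hE := SimpleGraph.Subgraph.IsMatching.subgraphOfAdj (hadj (2 * m))
    refine ⟨M ⊔ G.subgraphOfAdj (hadj (2 * m)), hM.sup hE ?_, ?_⟩
    · rw [hM.support_eq_verts, hE.support_eq_verts, hv, Set.disjoint_left]
      rintro _ ⟨x, hx, rfl⟩ h
      simp only [SimpleGraph.subgraphOfAdj_verts, Set.mem_insert_iff, Set.mem_singleton_iff,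
        Set.mem_Iio] at h hx
      rcases h with h | h
      · have := hinj (by simp only [Set.mem_Iio]; omega) (by simp only [Set.mem_Iio]; omega) h
        omega
      · have := hinj (by simp only [Set.mem_Iio]; omega) (by simp only [Set.mem_Iio]; omega) h
        omega
    · rw [SimpleGraph.Subgraph.verts_sup, hv, hIio, Set.image_union, Set.image_pair]
      rfl

/-- The support of a cycle along edges is covered by a matching up to a vertex of one's choice, and
entirely if its length is even. -/
theorem exists_isMatching_of_isCycle {V : Type*} [Fintype V] [DecidableEq V] (G : SimpleGraph V)
    (σ : Equiv.Perm V) (hσ : σ.IsCycle) (hadj : ∀ v ∈ σ.support, G.Adj v (σ v)) (x : V)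
    (hx : x ∈ σ.support) : ∃ M : G.Subgraph, M.IsMatching ∧ M.verts ⊆ σ.support ∧
      (∀ v ∈ σ.support, v ∉ M.verts → v = x) ∧ (Even #σ.support → M.verts = σ.support) := by
  have hord := hσ.orderOf
  have hpow : ∀ n : ℕ, (σ ^ n) x ∈ σ.support := fun n =>
    Equiv.Perm.pow_apply_mem_support.2 hx
  -- The walk starts at `σ x`, so that `x` comes last and is the vertex left over when the length is
  -- odd.
  have hrep : ∀ v ∈ σ.support, ∃ j < #σ.support, v = (σ ^ (j + 1)) x := by
    intro v hv
    have hsc := hσ.sameCycle (Equiv.Perm.mem_support.1 hx) (Equiv.Perm.mem_support.1 hv)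
    obtain ⟨i, h0, hi, h⟩ := hsc.exists_pow_eq''
    rw [hord] at hi
    exact ⟨i - 1, by omega, by rw [Nat.sub_add_cancel h0, h]⟩
  have hinj : Set.InjOn (fun j => (σ ^ (j + 1)) x) (Set.Iio #σ.support) := by
    have hsurj : Set.SurjOn (fun j => (σ ^ (j + 1)) x) (range #σ.support) σ.support := by
      intro v hv
      obtain ⟨j, hj, h⟩ := hrep v hv
      exact ⟨j, by simpa using hj, h.symm⟩
    have := injOn_of_surjOn_of_card_le _ (fun j _ => by simpa using hpow (j + 1)) hsurj (by simp)
    simpa using this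
  have hle : 2 * (#σ.support / 2) ≤ #σ.support := by omega
  obtain ⟨M, hM, hv⟩ := exists_isMatching_verts_image G (fun j => (σ ^ (j + 1)) x)
    (#σ.support / 2) (hinj.mono fun j hj => by simp only [Set.mem_Iio] at *; omega) fun j => by
      have := hadj _ (hpow (j + 1))
      rwa [← Equiv.Perm.mul_apply, ← pow_succ'] at this
  have hsub : M.verts ⊆ σ.support := by
    rw [hv]
    rintro _ ⟨j, -, rfl⟩
    exact hpow _
  have hmem : ∀ v ∈ σ.support, v ∉ M.verts → v = x ∧ ¬ Even #σ.support := by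
    intro v hvs hvM
    obtain ⟨j, hj, rfl⟩ := hrep v hvs
    have hj' : ¬ j < 2 * (#σ.support / 2) := fun h => hvM (hv ▸ ⟨j, h, rfl⟩)
    have hjeq : j + 1 = #σ.support := by omega
    refine ⟨by rw [hjeq, ← hord, pow_orderOf_eq_one, Equiv.Perm.one_apply], fun he => ?_⟩
    obtain ⟨r, hr⟩ := he
    omega
  refine ⟨M, hM, hsub, fun v hvs hvM => (hmem v hvs hvM).1, fun he => hsub.antisymm fun v hvs => ?_⟩
  by_contra hvM
  exact (hmem v hvs hvM).2 he

/-- A permutation along edges yields three matchings of which each vertex of the support is missed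
by at most one. -/
theorem exists_three_matchings {V : Type*} [Fintype V] [DecidableEq V] (G : SimpleGraph V)
    (σ : Equiv.Perm V) : (∀ v ∈ σ.support, G.Adj v (σ v)) →
    ∃ M : Fin 3 → G.Subgraph, (∀ i, (M i).IsMatching) ∧ (∀ i, (M i).verts ⊆ σ.support) ∧
      ∀ v ∈ σ.support, ∀ i j, v ∉ (M i).verts → v ∉ (M j).verts → i = j := by
  induction σ using Equiv.Perm.cycle_induction_on with
  | base_one => exact fun _ => ⟨fun _ => ⊥, fun _ v hv => absurd hv (by simp), by simp, by simp⟩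
  | base_cycles σ hσ =>
    intro hadj
    choose! M hM hsub hmiss heven using exists_isMatching_of_isCycle G σ hσ hadj
    rcases Nat.even_or_odd #σ.support with he | ho
    · obtain ⟨x, hx⟩ := card_pos.1 (Nat.zero_lt_two.trans_le hσ.two_le_card_support)
      refine ⟨fun _ => M x, fun _ => hM x hx, fun _ => hsub x hx, fun v hv i _ h => ?_⟩
      rw [heven x hx he] at h
      exact absurd hv h
    -- An odd cycle has at least three vertices, hence three distinct ones to leave out.
    · have h3 : Fintype.card (Fin 3) ≤ Fintype.card σ.support := by
        have := hσ.two_le_card_support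
        obtain ⟨r, hr⟩ := ho
        rw [Fintype.card_fin, Fintype.card_coe]
        omega
      obtain ⟨e⟩ := Function.Embedding.nonempty_of_card_le h3
      refine ⟨fun i => M (e i), fun i => hM _ (e i).2, fun i => hsub _ (e i).2,
        fun v hv i j hi hj => e.injective (Subtype.ext ?_)⟩
      exact (hmiss _ (e i).2 v hv hi).symm.trans (hmiss _ (e j).2 v hv hj)
  | induction_disjoint σ τ hd _ ihσ ihτ =>
    intro hadj
    have hsupp := hd.support_mul
    have hdisj := hd.disjoint_support
    obtain ⟨M, hM, hMs, hMm⟩ := ihσ fun v hv => by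
      have h := hadj v (by rw [hsupp]; exact mem_union_left _ hv)
      rwa [Equiv.Perm.mul_apply,
        Equiv.Perm.notMem_support.1 (disjoint_left.1 hdisj hv)] at h
    obtain ⟨N, hN, hNs, hNm⟩ := ihτ fun v hv => by
      have h := hadj v (by rw [hsupp]; exact mem_union_right _ hv)
      rwa [hd.commute.eq, Equiv.Perm.mul_apply,
        Equiv.Perm.notMem_support.1 (disjoint_right.1 hdisj hv)] at h
    refine ⟨fun i => M i ⊔ N i, fun i => (hM i).sup (hN i) ?_, fun i => ?_,
      fun v hv i j hi hj => ?_⟩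
    · rw [(hM i).support_eq_verts, (hN i).support_eq_verts]
      exact (disjoint_coe.2 hdisj).mono (hMs i) (hNs i)
    · rw [SimpleGraph.Subgraph.verts_sup, hsupp, coe_union]
      exact Set.union_subset_union (hMs i) (hNs i)
    · simp only [SimpleGraph.Subgraph.verts_sup, Set.mem_union, not_or] at hi hj
      rw [hsupp, mem_union] at hv
      rcases hv with hv | hv
      · exact hMm v hv i j hi.1 hj.1
      · exact hNm v hv i j hi.2 hj.2

/-- Adjacency is irreflexive, so `σ` moves every vertex, and each is covered by at least two of the
three matchings. -/
theorem two_thirds_le_pRVertices {V : Type*} [Fintype V] [DecidableEq V] [Nonempty V]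
    (G : SimpleGraph V) (σ : Equiv.Perm V) (hσ : ∀ v, G.Adj v (σ v)) :
    2 / 3 ≤ pRVertices G := by
  classical
  obtain ⟨M, hM, -, hmiss⟩ := exists_three_matchings G σ fun v _ => hσ v
  refine le_pRVertices_of_matchings G M hM (fun i => (M i).verts.toFinset) (fun i => by simp) _
    fun v => ?_
  have hle : #{i | v ∉ (M i).verts.toFinset} ≤ 1 := card_le_one.2 fun i hi j hj =>
    hmiss v (Equiv.Perm.mem_support.2 (hσ v).ne') i j (by simpa using hi) (by simpa using hj)
  have hadd := card_filter_add_card_filter_not (s := (univ : Finset (Fin 3)))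
    fun i => v ∈ (M i).verts.toFinset
  rw [card_univ, Fintype.card_fin] at hadd
  have : 2 ≤ #{i | v ∈ (M i).verts.toFinset} := by omega
  have : (2 : ℝ) ≤ #{i | v ∈ (M i).verts.toFinset} := by exact_mod_cast this
  rw [Fintype.card_fin]
  norm_num at this ⊢
  exact this

end Cycles

end FairMatching

theorem mainTheorem12 {V : Type*} [Fintype V] [DecidableEq V] [Nonempty V]
    (G : SimpleGraph V) [DecidableRel G.Adj] (hG : ∀ v : V, ∃ w : V, G.Adj v w) :
    ((∃ d : ℕ, G.IsRegularOfDegree d) → 2 / 3 ≤ FairMatching.pRVertices G) ∧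
    ((¬ ∃ d : ℕ, G.IsRegularOfDegree d) →
      1 / ((G.maxDegree : ℝ) - (G.minDegree : ℝ) + 1) ≤ FairMatching.pRVertices G) := by
  have hδ : 0 < G.minDegree := by
    obtain ⟨v, hv⟩ := G.exists_minimal_degree_vertex
    rw [hv, G.degree_pos_iff_exists_adj]
    exact hG v
  have hle : G.minDegree ≤ G.maxDegree := G.minDegree_le_maxDegree
  constructor
  · rintro ⟨d, hd⟩
    have hmax : G.maxDegree ≤ Fintype.card Unit * G.minDegree := by
      obtain ⟨v, hv⟩ := G.exists_minimal_degree_vertex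
      obtain ⟨w, hw⟩ := G.exists_maximal_degree_vertex
      rw [hv, hw, hd v, hd w, Fintype.card_unit, one_mul]
    obtain ⟨φ, hφ, hadj⟩ := FairMatching.exists_injective_adj (κ := Unit) G hδ hmax
    have hinj : Function.Injective fun v => (φ v).1 := fun a b h => hφ (Prod.ext h rfl)
    exact FairMatching.two_thirds_le_pRVertices G
      (Equiv.ofBijective _ (Finite.injective_iff_bijective.1 hinj)) hadj
  · intro hreg
    have hlt : G.minDegree < G.maxDegree := by
      refine lt_of_le_of_ne hle fun h => hreg ⟨G.maxDegree, fun v => ?_⟩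
      exact le_antisymm (G.degree_le_maxDegree v) (h ▸ G.minDegree_le_degree v)
    obtain ⟨e, he⟩ := Nat.exists_eq_add_of_lt hlt
    have hcard : Fintype.card (Fin (e + 2)) = e + 2 := Fintype.card_fin _
    -- Here `e + 2` is Δ - δ + 1, and (Δ - δ + 1)δ - Δ = (Δ - δ)(δ - 1) ≥ 0 because δ ≥ 1.
    have hbound := FairMatching.one_div_card_le_pRVertices (κ := Fin (e + 2)) G
      (FairMatching.exists_injective_adj G hδ (by rw [hcard, he]; nlinarith))
    rw [hcard] at hbound
    convert hbound using 2
    rw [he]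
    push_cast
    ring
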